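/- For $p\ge 0$ let $SO(p)$ be the group of real orthogonal $p\times p$ matrices of determinant $1$, with the bi-invariant Riemannian metric that equals $\langle A_1,A_2\rangle=-\tfrac12\operatorname{tr}(A_1A_2)$ on the Lie algebra $T_I SO(p)$ of antisymmetric matrices, and let $d_{SO}$ be its geodesic distance. An involution is an $R\in SO(p)$ with $R^2=I\ne R$; its level, $\operatorname{level}(R)$, is the dimension of the $(-1)$-eigenspace of $R$. Let $\mathcal I_p^+$ be the set of $\sigma=(\sigma_1,\dots,\sigma_p)\in\{\pm1\}^p$ with $\prod_i\sigma_i=1$; for $\sigma\in\mathcal I_p^+$ put $I_\sigma=\operatorname{diag}(\sigma_1,\dots,\sigma_p)\in SO(p)$ and $\operatorname{level}(\sigma)=\#\{i:\sigma_i=-1\}$. Say that $\sigma$ reduces $R$ if $d_{SO}(RI_\sigma,I)<d_{SO}(R,I)$, that $R$ is sign-change reducible if some $\sigma\in\mathcal I_p^+$ reduces $R$, and that $R$ is reducible by a sign change of level $m$ if some $\sigma\in\mathcal I_p^+$ of level $m$ reduces $R$. Proposition. (a) If $R\in SO(p)$ is an involution of level $2$ and $R$ is sign-change reducible, then $R$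 is reducible by a sign change of level $2$. (b) More generally, if $R\in SO(p)$ is any involution and $\sigma\in\mathcal I_p^+$ reduces $R$, then $\operatorname{level}(\sigma)<2\operatorname{level}(R)$. -/

import Mathlib

open scoped ENNReal

noncomputable section

/-- The special orthogonal group `SO(p)` of real `p × p` matrices. -/
abbrev SO (p : ℕ) := Matrix.specialOrthogonalGroup (Fin p) ℝ

/-- The bi-invariant Riemannian metric on `SO(p)` that is `⟨A₁, A₂⟩ = -(1/2) tr (A₁ A₂)` on the
antisymmetric matrices `so(p) = T_I SO(p)`. At `U`, the tangent vectors `X, Y` (matrices for which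
`Uᵀ X` and `Uᵀ Y` are antisymmetric) are left-translated to the identity by `U⁻¹ = Uᵀ`. -/
def soMetric {p : ℕ} (U X Y : Matrix (Fin p) (Fin p) ℝ) : ℝ :=
  -(1 / 2) * ((U.transpose * X) * (U.transpose * Y)).trace

/-- A `C¹` path `[0, 1] → SO(p)` from `U` to `V`. Since `SO(p)` is an embedded submanifold of the
space of matrices, being `C¹` is the same as having `C¹` matrix entries. (The values of `toFun`
outside `[0, 1]` play no role.) -/
structure SOPath {p : ℕ} (U V : SO p) where
  toFun : ℝ → Matrix (Fin p) (Fin p) ℝ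
  mem : ∀ t ∈ Set.Icc (0 : ℝ) 1, toFun t ∈ Matrix.specialOrthogonalGroup (Fin p) ℝ
  contDiffOn : ∀ i j, ContDiffOn ℝ 1 (fun t => toFun t i j) (Set.Icc 0 1)
  source : toFun 0 = (U : Matrix (Fin p) (Fin p) ℝ)
  target : toFun 1 = (V : Matrix (Fin p) (Fin p) ℝ)

/-- The velocity (entrywise derivative, one-sided at the end points) of a path in `SO(p)`. -/
def SOPath.velocity {p : ℕ} {U V : SO p} (γ : SOPath U V) (t : ℝ) : Matrix (Fin p) (Fin p) ℝ :=
  Matrix.of fun i j => derivWithin (fun s => γ.toFun s i j) (Set.Icc 0 1) t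

/-- The Riemannian length of a path in `SO(p)`. -/
def SOPath.length {p : ℕ} {U V : SO p} (γ : SOPath U V) : ℝ :=
  ∫ t in (0 : ℝ)..1, Real.sqrt (soMetric (γ.toFun t) (γ.velocity t) (γ.velocity t))

/-- The geodesic distance `d_SO(U, V)` of the Riemannian manifold `SO(p)`: the infimum of the
lengths of the `C¹` paths from `U` to `V`. As for Mathlib's `riemannianEDist`, it takes values
in `ℝ≥0∞` (the value `∞` does not occur, since `SO(p)` is connected). -/
def soDist {p : ℕ} (U V : SO p) : ℝ≥0∞ :=
  ⨅ γ : SOPath U V, ENNReal.ofReal γ.length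

/-- The group `I_p⁺` of even sign changes: tuples `σ ∈ {±1}^p` with `∏ σᵢ = 1`. -/
abbrev EvenSignChange (p : ℕ) : Type := {σ : Fin p → ℤˣ // ∏ i, σ i = 1}

/-- The level of a sign change `σ`: the number of indices `i` with `σᵢ = -1`. -/
def EvenSignChange.level {p : ℕ} (σ : EvenSignChange p) : ℕ :=
  (Finset.univ.filter fun i => σ.1 i = -1).card

/-- The sign-change matrix `I_σ = diag(σ₁, …, σ_p)`, an element of `SO(p)`. -/
def EvenSignChange.toSO {p : ℕ} (σ : EvenSignChange p) : SO p :=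
  ⟨Matrix.diagonal fun i => ((σ.1 i : ℤ) : ℝ), by
    have hsq : ∀ i, ((σ.1 i : ℤ) : ℝ) * ((σ.1 i : ℤ) : ℝ) = 1 := fun i => by
      rcases Int.units_eq_one_or (σ.1 i) with h | h <;> simp [h]
    have hprod : ∏ i, ((σ.1 i : ℤ) : ℝ) = 1 := by
      have h := congrArg (fun u : ℤˣ => ((u : ℤ) : ℝ)) σ.2
      simpa using h
    rw [Matrix.mem_specialOrthogonalGroup_iff, Matrix.mem_orthogonalGroup_iff]
    refine ⟨?_, by rw [Matrix.det_diagonal, hprod]⟩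
    rw [Matrix.diagonal_transpose, Matrix.diagonal_mul_diagonal,
      ← Matrix.diagonal_one]
    congr 1
    funext i
    exact hsq i⟩

/-- `R ∈ SO(p)` is an involution: `R² = I ≠ R`. -/
def IsSOInvolution {p : ℕ} (R : SO p) : Prop := R * R = 1 ∧ R ≠ 1

/-- The level of `R`: the dimension of its `(-1)`-eigenspace. -/
def soLevel {p : ℕ} (R : SO p) : ℕ :=
  Module.finrank ℝ
    (Module.End.eigenspace (Matrix.toLin' (R : Matrix (Fin p) (Fin p) ℝ)) (-1))

/-- The sign change `σ` reduces `R`: `d_SO(R I_σ, I) < d_SO(R, I)`. -/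
def EvenSignChange.Reduces {p : ℕ} (σ : EvenSignChange p) (R : SO p) : Prop :=
  soDist (R * σ.toSO) 1 < soDist R 1

/-- `R` is sign-change reducible: some even sign change reduces it. -/
def IsSignChangeReducible {p : ℕ} (R : SO p) : Prop :=
  ∃ σ : EvenSignChange p, σ.Reduces R

/-- `R` is reducible by a sign change of level `m`. -/
def IsReducibleByLevel {p : ℕ} (R : SO p) (m : ℕ) : Prop :=
  ∃ σ : EvenSignChange p, σ.level = m ∧ σ.Reduces R

end

/-!
Two estimates of the geodesic distance to the identity carry the proof; no minimal geodesics or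
logarithms are needed.

*Lower bound* (`SOPath.pi_mul_sqrt_le_length`, `ofReal_le_soDist_one`). If `U ∈ SO(p)` is `-1` on
an `n`-dimensional space with orthonormal basis `E`, then along any path `γ` from `U` to `1` the
matrix `γ E` moves on the sphere of radius `√n` for the Frobenius norm, from `-E` to `E`, and so
covers a distance of at least `π √n`. The Riemannian speed of `γ` is `1 / √2` times the Frobenius
norm of `γ'`, hence at least `1 / √2` times that of `γ' E`, so `d(U, 1) ≥ π √(n / 2)`.

*Upper bound* (`exists_SOPath_length_eq`). An involution `R` of level `r` is `-1` on a space of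
even dimension `r`; rotating this space by the angles between `π` and `0` in a complex structure
gives a path of length `π √(r / 2)` from `R` to `1`.

Let `s` be the level of `σ`. The `(-1)`-eigenspace of `I_σ` meets the `1`-eigenspace of `R` in
dimension at least `s - r`, and `R I_σ` is `-1` there. If `s ≥ 2 r` this dimension is at least `r`,
so `d(R I_σ, 1) ≥ π √(r / 2) ≥ d(R, 1)` and `σ` does not reduce `R`. When `r = 2`, a reducing `σ`
therefore has level less than `4`; the level is even and not `0`, as the identity reduces nothing,
so it is `2`.
-/

/-! ### The Frobenius inner product -/

open Matrix in
theorem Matrix.trace_transpose_mul_eq_sum {m n : Type*} [Fintype m] [Fintype n]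
    (A B : Matrix m n ℝ) : (Aᵀ * B).trace = ∑ x : n × m, A x.2 x.1 * B x.2 x.1 := by
  simp [Matrix.trace, Matrix.mul_apply, Fintype.sum_prod_type]

open Matrix in
theorem Matrix.trace_transpose_mul_self_nonneg {m n : Type*} [Fintype m] [Fintype n]
    (A : Matrix m n ℝ) : 0 ≤ (Aᵀ * A).trace := by
  rw [Matrix.trace_transpose_mul_eq_sum]
  exact Finset.sum_nonneg fun x _ => mul_self_nonneg _

open Matrix in
/-- The Cauchy–Schwarz inequality for the Frobenius inner product `tr (Aᵀ B)`. -/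
theorem Matrix.sq_trace_transpose_mul_le {m n : Type*} [Fintype m] [Fintype n]
    (A B : Matrix m n ℝ) : (Aᵀ * B).trace ^ 2 ≤ (Aᵀ * A).trace * (Bᵀ * B).trace := by
  simp only [Matrix.trace_transpose_mul_eq_sum]
  simpa only [sq] using Finset.sum_mul_sq_le_sq_mul_sq Finset.univ
    (fun x : n × m => A x.2 x.1) (fun x => B x.2 x.1)

open Matrix in
/-- Restricting `X` to the span of orthonormal vectors (the columns of `E`) does not increase its
Frobenius norm: the difference of the squares is the squared norm of `X (1 - E Eᵀ)`. -/
theorem Matrix.trace_transpose_mul_self_mul_le {m n k : Type*} [Fintype m] [Fintype n]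
    [Fintype k] [DecidableEq n] [DecidableEq k] (X : Matrix m n ℝ) {E : Matrix n k ℝ}
    (hE : Eᵀ * E = 1) : ((X * E)ᵀ * (X * E)).trace ≤ (Xᵀ * X).trace := by
  have h1 : ((X * E)ᵀ * (X * E)).trace = (Xᵀ * X * (E * Eᵀ)).trace := by
    rw [transpose_mul, Matrix.mul_assoc, Matrix.trace_mul_comm]
    simp only [Matrix.mul_assoc]
  have h2 : (1 - E * Eᵀ) * (1 - E * Eᵀ)ᵀ = 1 - E * Eᵀ := by
    have : E * Eᵀ * (E * Eᵀ) = E * Eᵀ := by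
      rw [Matrix.mul_assoc, ← Matrix.mul_assoc Eᵀ, hE, Matrix.one_mul]
    simp [Matrix.mul_sub, Matrix.sub_mul, this]
  have h3 : ((X * (1 - E * Eᵀ))ᵀ * (X * (1 - E * Eᵀ))).trace
      = (Xᵀ * X).trace - (Xᵀ * X * (E * Eᵀ)).trace := by
    rw [transpose_mul, Matrix.mul_assoc, Matrix.trace_mul_comm, Matrix.mul_assoc,
      Matrix.mul_assoc, h2, ← Matrix.mul_assoc, Matrix.mul_sub, Matrix.mul_one, Matrix.trace_sub]
  have h4 := Matrix.trace_transpose_mul_self_nonneg (X * (1 - E * Eᵀ))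
  linarith

/-! ### Paths on a sphere -/

/-- A function going from `-1` to `1` whose slope is at most `φ √(1 - f²)` needs `∫ φ ≥ π`.
With `f t = ⟪x t, x 1⟫` this is the fact that a path `x` on the unit sphere joining antipodal
points has length at least `π`. -/
theorem pi_le_integral_of_sq_deriv_le {f f' φ : ℝ → ℝ}
    (hf : ContinuousOn f (Set.Icc 0 1))
    (hf' : ∀ t ∈ Set.Ioo (0 : ℝ) 1, HasDerivAt f (f' t) t)
    (hφ : MeasureTheory.IntegrableOn φ (Set.Icc 0 1)) (hφ0 : ∀ t, 0 ≤ φ t)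
    (hf1 : ∀ t ∈ Set.Ioo (0 : ℝ) 1, f t ^ 2 ≤ 1)
    (hle : ∀ t ∈ Set.Ioo (0 : ℝ) 1, f' t ^ 2 ≤ φ t ^ 2 * (1 - f t ^ 2))
    (h0 : f 0 = -1) (h1 : f 1 = 1) : Real.pi ≤ ∫ t in (0 : ℝ)..1, φ t := by
  -- `arcsin ∘ f` need not be differentiable where `f = ±1`; `arcsin (c f)` with `c < 1` is.
  have key : ∀ c ∈ Set.Ioo (0 : ℝ) 1, 2 * Real.arcsin c ≤ ∫ t in (0 : ℝ)..1, φ t := by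
    rintro c ⟨hc0, hc1⟩
    have hc2 : c ^ 2 < 1 := by nlinarith
    have hlt : ∀ t ∈ Set.Ioo (0 : ℝ) 1, (c * f t) ^ 2 < 1 := fun t ht => by
      have := hf1 t ht
      nlinarith [mul_le_mul_of_nonneg_left this (sq_nonneg c)]
    have := intervalIntegral.sub_le_integral_of_hasDeriv_right_of_le
      (g := fun t => Real.arcsin (c * f t))
      (g' := fun t => 1 / √(1 - (c * f t) ^ 2) * (c * f' t)) zero_le_one
      (Real.continuous_arcsin.comp_continuousOn (continuousOn_const.mul hf))
      (fun t ht => ((Real.hasDerivAt_arcsin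
          (fun h => by have := hlt t ht; rw [h] at this; norm_num at this)
          (fun h => by have := hlt t ht; rw [h] at this; norm_num at this)).comp t
          ((hf' t ht).const_mul c)).hasDerivWithinAt) hφ
      (fun t ht => by
        have hpos : 0 < 1 - (c * f t) ^ 2 := by linarith [hlt t ht]
        rw [one_div_mul_eq_div, div_le_iff₀ (Real.sqrt_pos.2 hpos)]
        apply le_of_abs_le
        refine abs_le_of_sq_le_sq ?_ (mul_nonneg (hφ0 t) (Real.sqrt_nonneg _))
        rw [mul_pow, mul_pow, Real.sq_sqrt hpos.le]
        calc c ^ 2 * f' t ^ 2 ≤ c ^ 2 * (φ t ^ 2 * (1 - f t ^ 2)) := by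
              gcongr; exact hle t ht
          _ = φ t ^ 2 * (c ^ 2 - (c * f t) ^ 2) := by ring
          _ ≤ φ t ^ 2 * (1 - (c * f t) ^ 2) := by gcongr)
    simp only [h0, h1, mul_neg, mul_one, Real.arcsin_neg] at this
    linarith
  have hlim : Filter.Tendsto (fun c : ℝ => 2 * Real.arcsin c) (nhdsWithin 1 (Set.Iio 1))
      (nhds Real.pi) := by
    have h : Filter.Tendsto (fun c : ℝ => 2 * Real.arcsin c) (nhds 1)
        (nhds (2 * Real.arcsin 1)) := by
      exact (continuous_const.mul Real.continuous_arcsin).tendsto 1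
    rw [Real.arcsin_one, mul_div_cancel₀ _ (two_ne_zero' ℝ)] at h
    exact h.mono_left nhdsWithin_le_nhds
  exact le_of_tendsto hlim (Filter.eventually_of_mem
    (Ioo_mem_nhdsLT zero_lt_one) key)

/-! ### Lengths of paths in `SO(p)` -/

namespace SOPath

open Matrix

variable {p : ℕ} {U V : SO p} (γ : SOPath U V)

theorem transpose_mul_self {t : ℝ} (ht : t ∈ Set.Icc (0 : ℝ) 1) :
    (γ.toFun t)ᵀ * γ.toFun t = 1 :=
  (Matrix.mem_orthogonalGroup_iff' (Fin p) ℝ).1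
    (Matrix.mem_specialOrthogonalGroup_iff.1 (γ.mem t ht)).1

theorem mul_transpose_self {t : ℝ} (ht : t ∈ Set.Icc (0 : ℝ) 1) :
    γ.toFun t * (γ.toFun t)ᵀ = 1 :=
  mul_eq_one_comm.1 (γ.transpose_mul_self ht)

theorem hasDerivAt {t : ℝ} (ht : t ∈ Set.Ioo (0 : ℝ) 1) (i j : Fin p) :
    HasDerivAt (fun s => γ.toFun s i j) (γ.velocity t i j) t :=
  (((γ.contDiffOn i j).differentiableOn one_ne_zero t
    (Set.Ioo_subset_Icc_self ht)).hasDerivWithinAt).hasDerivAt (Icc_mem_nhds ht.1 ht.2)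

/-- The velocity of a path in `SO(p)` is a tangent vector: its left translate to the identity
is antisymmetric. -/
theorem transpose_mul_velocity_antisymm {t : ℝ} (ht : t ∈ Set.Ioo (0 : ℝ) 1) :
    (γ.velocity t)ᵀ * γ.toFun t = -((γ.toFun t)ᵀ * γ.velocity t) := by
  rw [eq_neg_iff_add_eq_zero]
  ext i j
  have h1 : HasDerivAt (fun s => ((γ.toFun s)ᵀ * γ.toFun s) i j)
      (((γ.velocity t)ᵀ * γ.toFun t + (γ.toFun t)ᵀ * γ.velocity t) i j) t := by
    simp only [Matrix.mul_apply, Matrix.add_apply, Matrix.transpose_apply,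
      ← Finset.sum_add_distrib]
    exact HasDerivAt.fun_sum fun k _ => (γ.hasDerivAt ht k i).mul (γ.hasDerivAt ht k j)
  refine h1.unique
    ((hasDerivAt_const t ((1 : Matrix (Fin p) (Fin p) ℝ) i j)).congr_of_eventuallyEq ?_)
  filter_upwards [Icc_mem_nhds ht.1 ht.2] with s hs
  rw [γ.transpose_mul_self hs]

end SOPath

open Matrix in
/-- On tangent vectors the metric is half the Frobenius inner product. -/
theorem soMetric_self_of_antisymm {p : ℕ} {U X : Matrix (Fin p) (Fin p) ℝ} (hU : U * Uᵀ = 1)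
    (hX : Xᵀ * U = -(Uᵀ * X)) : soMetric U X X = (Xᵀ * X).trace / 2 := by
  have : Uᵀ * X * (Uᵀ * X) = -(Xᵀ * X) :=
    calc Uᵀ * X * (Uᵀ * X) = -(Xᵀ * U) * (Uᵀ * X) := by rw [hX, neg_neg]
      _ = -(Xᵀ * (U * Uᵀ * X)) := by simp only [neg_mul, Matrix.mul_assoc]
      _ = -(Xᵀ * X) := by rw [hU, Matrix.one_mul]
  rw [soMetric, this, Matrix.trace_neg]
  ring

namespace SOPath

open Matrix

variable {p : ℕ} {U V : SO p} (γ : SOPath U V)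

theorem continuousOn_toFun : ContinuousOn γ.toFun (Set.Icc 0 1) :=
  continuousOn_pi.2 fun i => continuousOn_pi.2 fun j => (γ.contDiffOn i j).continuousOn

theorem continuousOn_velocity : ContinuousOn γ.velocity (Set.Icc 0 1) :=
  continuousOn_pi.2 fun i => continuousOn_pi.2 fun j =>
    (γ.contDiffOn i j).continuousOn_derivWithin (uniqueDiffOn_Icc zero_lt_one) le_rfl

theorem _root_.continuous_soMetric : Continuous
    fun A : Matrix (Fin p) (Fin p) ℝ × Matrix (Fin p) (Fin p) ℝ => soMetric A.1 A.2 A.2 := by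
  unfold soMetric
  exact continuous_const.mul
      ((continuous_fst.matrix_transpose.matrix_mul continuous_snd).matrix_mul
        (continuous_fst.matrix_transpose.matrix_mul continuous_snd)).matrix_trace

theorem continuousOn_sqrt_soMetric :
    ContinuousOn (fun t => √(soMetric (γ.toFun t) (γ.velocity t) (γ.velocity t)))
      (Set.Icc 0 1) :=
  (continuous_soMetric.comp_continuousOn
    (γ.continuousOn_toFun.prodMk γ.continuousOn_velocity)).sqrt

theorem length_nonneg : 0 ≤ γ.length :=
  intervalIntegral.integral_nonneg zero_le_one fun _ _ => Real.sqrt_nonneg _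

/-- A path in `SO(p)` that ends at `1` and starts at an element equal to `-1` on an
`n`-dimensional space has length at least `π √(n/2)`. If the columns of `E` are an orthonormal
basis of that space, `t ↦ γ t * E` is a path between antipodal points of the sphere of radius
`√n` for the Frobenius norm, and its speed is at most `√2` times the speed of `γ`. -/
theorem pi_mul_sqrt_le_length {U : SO p} (γ : SOPath U 1) {n : ℕ} {E : Matrix (Fin p) (Fin n) ℝ}
    (hE : Eᵀ * E = 1) (hUE : (U : Matrix (Fin p) (Fin p) ℝ) * E = -E) :
    Real.pi * √(n / 2) ≤ γ.length := by
  rcases Nat.eq_zero_or_pos n with rfl | hn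
  · simpa using γ.length_nonneg
  have hn' : (0 : ℝ) < n := by exact_mod_cast hn
  have htr : (Eᵀ * E).trace = n := by rw [hE, Matrix.trace_one, Fintype.card_fin]
  set φ := fun t => √(soMetric (γ.toFun t) (γ.velocity t) (γ.velocity t)) with hφ
  set f : ℝ → ℝ := fun t => (Eᵀ * (γ.toFun t * E)).trace / n with hf
  have hnorm : ∀ t ∈ Set.Icc (0 : ℝ) 1,
      ((γ.toFun t * E)ᵀ * (γ.toFun t * E)).trace = n := fun t ht => by
    rw [transpose_mul, Matrix.mul_assoc, ← Matrix.mul_assoc (γ.toFun t)ᵀ,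
      γ.transpose_mul_self ht, Matrix.one_mul, htr]
  have hcont : ContinuousOn f (Set.Icc 0 1) := by
    have h1 : Continuous fun A : Matrix (Fin p) (Fin p) ℝ => (Eᵀ * (A * E)).trace / n := by
      fun_prop
    exact h1.comp_continuousOn γ.continuousOn_toFun
  have hderiv : ∀ t ∈ Set.Ioo (0 : ℝ) 1,
      HasDerivAt f ((Eᵀ * (γ.velocity t * E)).trace / n) t := fun t ht => by
    refine HasDerivAt.div_const ?_ _
    simp only [Matrix.trace_transpose_mul_eq_sum, Matrix.mul_apply]
    exact HasDerivAt.fun_sum fun x _ => (HasDerivAt.fun_sum fun k _ =>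
      (γ.hasDerivAt ht _ _).mul_const _).const_mul _
  have hint : MeasureTheory.IntegrableOn (fun t => √2 / √n * φ t) (Set.Icc 0 1) :=
    (continuousOn_const.mul γ.continuousOn_sqrt_soMetric).integrableOn_Icc
  have hmain := pi_le_integral_of_sq_deriv_le hcont hderiv hint
    (fun t => by positivity) (fun t ht => ?_) (fun t ht => ?_) ?_ ?_
  · rw [intervalIntegral.integral_const_mul] at hmain
    change _ ≤ _ * γ.length at hmain
    calc Real.pi * √(n / 2) ≤ (√2 / √n * γ.length) * √(n / 2) := by gcongr
      _ = γ.length := by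
        rw [Real.sqrt_div hn'.le]
        field_simp
  · have h := Matrix.sq_trace_transpose_mul_le E (γ.toFun t * E)
    rw [htr, hnorm t (Set.Ioo_subset_Icc_self ht)] at h
    rw [hf, div_pow, div_le_one (by positivity)]
    linarith
  · have ht' := Set.Ioo_subset_Icc_self ht
    have hanti := γ.transpose_mul_velocity_antisymm ht
    have hsq : φ t ^ 2 = ((γ.velocity t)ᵀ * γ.velocity t).trace / 2 := by
      have := soMetric_self_of_antisymm (γ.mul_transpose_self ht') hanti
      rw [hφ, ← this, Real.sq_sqrt]
      rw [this]
      linarith [Matrix.trace_transpose_mul_self_nonneg (γ.velocity t)]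
    -- the velocity of a path on the sphere is orthogonal to the position
    have horth : ((γ.toFun t * E)ᵀ * (γ.velocity t * E)).trace = 0 := by
      have h1 : ((γ.toFun t * E)ᵀ * (γ.velocity t * E)).trace
          = ((γ.velocity t * E)ᵀ * (γ.toFun t * E)).trace := by
        rw [← Matrix.trace_transpose, transpose_mul, transpose_transpose]
      have h2 : (γ.velocity t * E)ᵀ * (γ.toFun t * E)
          = -((γ.toFun t * E)ᵀ * (γ.velocity t * E)) := by
        simp only [transpose_mul, Matrix.mul_assoc]
        rw [← Matrix.mul_assoc (γ.velocity t)ᵀ, hanti]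
        simp [Matrix.mul_assoc]
      rw [h2, Matrix.trace_neg] at h1
      linarith
    have hft : (Eᵀ * (γ.toFun t * E)).trace = n * f t := by
      rw [hf]; field_simp
    have hft' : ((γ.toFun t * E)ᵀ * E).trace = n * f t := by
      rw [← hft, ← Matrix.trace_transpose, transpose_mul, transpose_transpose]
    have hcs := Matrix.sq_trace_transpose_mul_le (E - f t • (γ.toFun t * E)) (γ.velocity t * E)
    have e1 : ((E - f t • (γ.toFun t * E))ᵀ * (γ.velocity t * E)).trace
        = (Eᵀ * (γ.velocity t * E)).trace := by
      rw [transpose_sub, transpose_smul, Matrix.sub_mul, Matrix.smul_mul, Matrix.trace_sub,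
        Matrix.trace_smul, horth, smul_zero, sub_zero]
    have e2 : ((E - f t • (γ.toFun t * E))ᵀ * (E - f t • (γ.toFun t * E))).trace
        = n * (1 - f t ^ 2) := by
      rw [transpose_sub, transpose_smul, Matrix.sub_mul, Matrix.smul_mul, Matrix.mul_sub,
        Matrix.mul_sub, Matrix.mul_smul, Matrix.mul_smul]
      simp only [Matrix.trace_sub, Matrix.trace_smul, smul_eq_mul, hft, hft', htr,
        hnorm t ht']
      ring
    rw [e1, e2] at hcs
    have hbessel := Matrix.trace_transpose_mul_self_mul_le (γ.velocity t) hE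
    have hnn : 0 ≤ n * (1 - f t ^ 2) := e2 ▸ Matrix.trace_transpose_mul_self_nonneg _
    rw [mul_pow, div_pow, div_pow, Real.sq_sqrt zero_le_two, Real.sq_sqrt hn'.le, hsq,
      div_le_iff₀ (by positivity)]
    calc _ ≤ _ := hcs
      _ ≤ n * (1 - f t ^ 2) * ((γ.velocity t)ᵀ * γ.velocity t).trace := by gcongr
      _ = _ := by field_simp
  · rw [hf]
    simp only [γ.source, hUE, Matrix.mul_neg, Matrix.trace_neg, htr]
    field_simp
  · rw [hf]
    simp only [γ.target, OneMemClass.coe_one, Matrix.one_mul, htr]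
    field_simp

end SOPath

open Matrix

/-! ### Orthonormal bases as matrices -/

/-- Every subspace of `ℝᵖ` has an orthonormal basis, here the columns of a matrix `E`; then
`E * Eᵀ` is the orthogonal projection onto the subspace. -/
theorem Submodule.exists_orthonormal_matrix {p : ℕ} (K : Submodule ℝ (Fin p → ℝ)) :
    ∃ E : Matrix (Fin p) (Fin (Module.finrank ℝ K)) ℝ, Eᵀ * E = 1 ∧
      (∀ j, E.col j ∈ K) ∧ ∀ v ∈ K, (E * Eᵀ) *ᵥ v = v := by
  let e := (WithLp.linearEquiv 2 ℝ (Fin p → ℝ)).symm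
  let K' : Submodule ℝ (EuclideanSpace ℝ (Fin p)) := K.map e.toLinearMap
  have hK : Module.finrank ℝ K' = Module.finrank ℝ K := LinearEquiv.finrank_map_eq e K
  let b := (stdOrthonormalBasis ℝ K').reindex (finCongr hK)
  refine ⟨Matrix.of fun i j => (b j : EuclideanSpace ℝ (Fin p)) i, ?_, fun j => ?_,
    fun v hv => ?_⟩
  · ext i j
    have h := orthonormal_iff_ite.1 b.orthonormal i j
    rw [Submodule.coe_inner, PiLp.inner_apply] at h
    simp only [Matrix.mul_apply, Matrix.transpose_apply, Matrix.of_apply, Matrix.one_apply, ← h]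
    simp [mul_comm]
  · obtain ⟨w, hw, hwj⟩ := (b j).2
    have : Matrix.col (Matrix.of fun i j => (b j : EuclideanSpace ℝ (Fin p)) i) j = w := by
      ext i
      rw [Matrix.col_apply, Matrix.of_apply, ← hwj]
      rfl
    rwa [this]
  · have h := b.sum_repr' ⟨e v, Submodule.mem_map_of_mem hv⟩
    have h' := congrArg (fun x : K' => (x : EuclideanSpace ℝ (Fin p))) h
    ext i
    have h2 := congrArg (fun x : EuclideanSpace ℝ (Fin p) => x i) h'
    simp only [Submodule.coe_sum, Submodule.coe_smul, WithLp.ofLp_sum, Finset.sum_apply,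
      Submodule.coe_inner, PiLp.inner_apply, WithLp.ofLp_smul, Pi.smul_apply, smul_eq_mul] at h2
    rw [← Matrix.mulVec_mulVec]
    simp only [Matrix.mulVec, dotProduct, Matrix.transpose_apply, Matrix.of_apply]
    refine Eq.trans (Finset.sum_congr rfl fun j _ => ?_) h2
    rw [mul_comm]
    congr 1
    refine Finset.sum_congr rfl fun k _ => ?_
    simp [e, mul_comm]

theorem SO.mul_transpose_self {p : ℕ} (R : SO p) :
    (R : Matrix (Fin p) (Fin p) ℝ) * (R : Matrix (Fin p) (Fin p) ℝ)ᵀ = 1 :=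
  (Matrix.mem_orthogonalGroup_iff (Fin p) ℝ).1
    (Matrix.mem_specialOrthogonalGroup_iff.1 R.2).1

/-! ### Involutions -/

section Involution

variable {p : ℕ} {R : SO p}

theorem SO.coe_mul_self (hR : R * R = 1) :
    (R : Matrix (Fin p) (Fin p) ℝ) * (R : Matrix (Fin p) (Fin p) ℝ) = 1 := by
  simpa using congrArg (fun X : SO p => (X : Matrix (Fin p) (Fin p) ℝ)) hR

theorem SO.transpose_eq_self (hR : R * R = 1) :
    (R : Matrix (Fin p) (Fin p) ℝ)ᵀ = R := by
  calc (R : Matrix (Fin p) (Fin p) ℝ)ᵀ = (R * R) * (R : Matrix (Fin p) (Fin p) ℝ)ᵀ := by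
        rw [SO.coe_mul_self hR, Matrix.one_mul]
    _ = R := by rw [Matrix.mul_assoc, SO.mul_transpose_self, Matrix.mul_one]

theorem mem_eigenspace_neg_one {v : Fin p → ℝ} :
    v ∈ Module.End.eigenspace (Matrix.toLin' (R : Matrix (Fin p) (Fin p) ℝ)) (-1) ↔
      (R : Matrix (Fin p) (Fin p) ℝ) *ᵥ v = -v := by
  rw [Module.End.mem_eigenspace_iff, Matrix.toLin'_apply, neg_smul, one_smul]

/-- An involution `R` is the reflection `1 - 2 E Eᵀ`, where the columns of `E` are an orthonormal
basis of its `(-1)`-eigenspace. -/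
theorem SO.exists_eq_one_sub_of_involution (hR : R * R = 1) :
    ∃ E : Matrix (Fin p) (Fin (soLevel R)) ℝ, Eᵀ * E = 1 ∧
      (R : Matrix (Fin p) (Fin p) ℝ) = 1 - (2 : ℝ) • (E * Eᵀ) := by
  obtain ⟨E, hE, hcol, hfix⟩ := Submodule.exists_orthonormal_matrix
    (Module.End.eigenspace (Matrix.toLin' (R : Matrix (Fin p) (Fin p) ℝ)) (-1))
  have hRE : (R : Matrix (Fin p) (Fin p) ℝ) * E = -E := by
    ext i j
    exact congrFun (mem_eigenspace_neg_one.1 (hcol j)) i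
  have h1 : (E * Eᵀ) * (1 - (R : Matrix (Fin p) (Fin p) ℝ)) =
      1 - (R : Matrix (Fin p) (Fin p) ℝ) := by
    ext i j
    have h := hfix ((1 - (R : Matrix (Fin p) (Fin p) ℝ)).col j) (by
      rw [mem_eigenspace_neg_one]
      have h2 : (R : Matrix (Fin p) (Fin p) ℝ) * (1 - (R : Matrix (Fin p) (Fin p) ℝ)) =
          -(1 - (R : Matrix (Fin p) (Fin p) ℝ)) := by
        rw [Matrix.mul_sub, SO.coe_mul_self hR, Matrix.mul_one, neg_sub]
      ext i
      exact congrFun (congrFun h2 i) j)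
    exact congrFun h i
  have h2 : Eᵀ * (R : Matrix (Fin p) (Fin p) ℝ) = -Eᵀ := by
    have := congrArg transpose hRE
    rwa [transpose_mul, transpose_neg, SO.transpose_eq_self hR] at this
  rw [Matrix.mul_sub, Matrix.mul_one, Matrix.mul_assoc, h2, Matrix.mul_neg, sub_neg_eq_add] at h1
  have h3 : (R : Matrix (Fin p) (Fin p) ℝ) = 1 - (2 : ℝ) • (E * Eᵀ) := by
    rw [two_smul, h1, sub_sub_cancel]
  exact ⟨E, hE, h3⟩

/-- The level of an involution in `SO(p)` is even, its determinant being `(-1) ^ level`. -/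
theorem even_soLevel (hR : R * R = 1) : Even (soLevel R) := by
  obtain ⟨E, hE, hRE⟩ := SO.exists_eq_one_sub_of_involution hR
  have hdet := (Matrix.mem_specialOrthogonalGroup_iff.1 R.2).2
  have h : (1 : Matrix (Fin p) (Fin p) ℝ) - (2 : ℝ) • (E * Eᵀ) = 1 + ((-2 : ℝ) • E) * Eᵀ := by
    rw [Matrix.smul_mul, neg_smul, sub_eq_add_neg]
  have h' : (1 : Matrix (Fin (soLevel R)) (Fin (soLevel R)) ℝ) + (-2 : ℝ) • 1 = (-1 : ℝ) • 1 := by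
    module
  rw [hRE, h, Matrix.det_one_add_mul_comm, Matrix.mul_smul, hE, h', Matrix.det_smul,
    Matrix.det_one, mul_one, Fintype.card_fin] at hdet
  by_contra hodd
  rw [Nat.not_even_iff_odd] at hodd
  rw [hodd.neg_one_pow] at hdet
  norm_num at hdet

/-- The orthogonal projection onto the `(-1)`-eigenspace of an involution `R`, of even rank
`soLevel R`, carries a complex structure: an antisymmetric `A` with `A² = -P`. -/
theorem SO.exists_complex_structure (hR : R * R = 1) :
    ∃ P A : Matrix (Fin p) (Fin p) ℝ, (R : Matrix (Fin p) (Fin p) ℝ) = 1 - (2 : ℝ) • P ∧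
      P.trace = soLevel R ∧ Pᵀ = P ∧ Aᵀ = -A ∧ P * P = P ∧ P * A = A ∧ A * P = A ∧
      A * A = -P := by
  obtain ⟨E, hE, hRE⟩ := SO.exists_eq_one_sub_of_involution hR
  obtain ⟨k, hk⟩ := even_soLevel hR
  let e : Fin k ⊕ Fin k ≃ Fin (soLevel R) := finSumFinEquiv.trans (finCongr hk.symm)
  -- the standard symplectic matrix, on coordinates paired off by `e`
  let J : Matrix (Fin (soLevel R)) (Fin (soLevel R)) ℝ :=
    (Matrix.J (Fin k) ℝ).submatrix e.symm e.symm
  have hJ : J * J = -1 := by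
    simp only [J]
    rw [Matrix.submatrix_mul_equiv, Matrix.J_squared, Matrix.submatrix_neg, Pi.neg_apply,
      Pi.neg_apply, Matrix.submatrix_one_equiv]
  have hJt : Jᵀ = -J := by
    simp only [J]
    rw [Matrix.transpose_submatrix, Matrix.J_transpose]
    rfl
  have hcancel : ∀ {n : ℕ} (X : Matrix (Fin (soLevel R)) (Fin n) ℝ),
      Eᵀ * (E * X) = X := fun X => by
    rw [← Matrix.mul_assoc, hE, Matrix.one_mul]
  refine ⟨E * Eᵀ, E * J * Eᵀ, hRE, ?_, ?_, ?_, ?_, ?_, ?_, ?_⟩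
  · rw [Matrix.trace_mul_comm, hE, Matrix.trace_one, Fintype.card_fin]
  · rw [transpose_mul, transpose_transpose]
  · simp [transpose_mul, hJt, Matrix.mul_assoc]
  · rw [Matrix.mul_assoc, hcancel]
  · rw [Matrix.mul_assoc, Matrix.mul_assoc, hcancel]
  · rw [Matrix.mul_assoc, hcancel]
  · rw [Matrix.mul_assoc, Matrix.mul_assoc, Matrix.mul_assoc, hcancel, ← Matrix.mul_assoc J, hJ,
      Matrix.neg_mul, Matrix.one_mul, Matrix.mul_neg]

end Involution

/-! ### A path from an involution to the identity -/

section Rotation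

variable {p : ℕ} {P A : Matrix (Fin p) (Fin p) ℝ}

/-- Given a projection `P` and an `A` with `A² = -P`, the rotation by the angle `θ` in the
complex structure `A` on the range of `P`, and the identity on the kernel of `P`. -/
noncomputable def Matrix.complexRotation (P A : Matrix (Fin p) (Fin p) ℝ) (θ : ℝ) :
    Matrix (Fin p) (Fin p) ℝ :=
  1 + (Real.cos θ - 1) • P + Real.sin θ • A

theorem Matrix.complexRotation_add (hP : P * P = P) (hPA : P * A = A) (hAP : A * P = A)
    (hA : A * A = -P) (θ ψ : ℝ) :
    complexRotation P A (θ + ψ) = complexRotation P A θ * complexRotation P A ψ := by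
  simp only [complexRotation, Real.cos_add, Real.sin_add, add_mul, mul_add, one_mul, mul_one,
    Matrix.smul_mul, Matrix.mul_smul, hP, hPA, hAP, hA]
  module

theorem Matrix.transpose_complexRotation (hPt : Pᵀ = P) (hAt : Aᵀ = -A) (θ : ℝ) :
    (complexRotation P A θ)ᵀ = complexRotation P A (-θ) := by
  simp [complexRotation, transpose_add, transpose_smul, hPt, hAt]

theorem Matrix.complexRotation_zero : complexRotation P A 0 = 1 := by simp [complexRotation]

theorem Matrix.complexRotation_mem_specialOrthogonalGroup (hPt : Pᵀ = P) (hAt : Aᵀ = -A)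
    (hP : P * P = P) (hPA : P * A = A) (hAP : A * P = A) (hA : A * A = -P) (θ : ℝ) :
    complexRotation P A θ ∈ specialOrthogonalGroup (Fin p) ℝ := by
  have horth : ∀ ψ, complexRotation P A ψ * (complexRotation P A ψ)ᵀ = 1 := fun ψ => by
    rw [transpose_complexRotation hPt hAt, ← complexRotation_add hP hPA hAP hA, add_neg_cancel,
      complexRotation_zero]
  rw [mem_specialOrthogonalGroup_iff, mem_orthogonalGroup_iff]
  refine ⟨horth θ, ?_⟩
  -- a rotation is the square of an orthogonal matrix, the rotation by half the angle
  have h := congrArg Matrix.det (horth (θ / 2))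
  rw [Matrix.det_mul, Matrix.det_transpose, Matrix.det_one] at h
  rw [← add_halves θ, complexRotation_add hP hPA hAP hA, Matrix.det_mul, h]

end Rotation

/-- An involution is joined to the identity by a one-parameter group of rotations of its
`(-1)`-eigenspace, a path of length `π √(level / 2)`. -/
theorem exists_SOPath_length_eq {p : ℕ} {R : SO p} (hR : R * R = 1) :
    ∃ γ : SOPath R 1, γ.length = Real.pi * √(soLevel R / 2) := by
  obtain ⟨P, A, hRP, htr, hPt, hAt, hP, hPA, hAP, hA⟩ := SO.exists_complex_structure hR
  have hderiv : ∀ i j t, HasDerivAt (fun s => complexRotation P A (Real.pi * (1 - s)) i j)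
      ((Real.pi • (Real.sin (Real.pi * (1 - t)) • P - Real.cos (Real.pi * (1 - t)) • A)) i j)
      t := fun i j t => by
    have hl : HasDerivAt (fun s : ℝ => Real.pi * (1 - s)) (Real.pi * (-1)) t :=
      ((hasDerivAt_id t).const_sub 1).const_mul Real.pi
    have h := ((hl.cos.sub_const 1).mul_const (P i j)).add (hl.sin.mul_const (A i j))
    have h' := h.const_add ((1 : Matrix (Fin p) (Fin p) ℝ) i j)
    refine (h'.congr_deriv ?_).congr_of_eventuallyEq (Filter.Eventually.of_forall fun s => ?_)
    · simp only [Matrix.smul_apply, Matrix.sub_apply, smul_eq_mul]; ring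
    · simp only [complexRotation, Matrix.smul_apply, Matrix.add_apply, smul_eq_mul,
        Pi.add_apply]
      ring
  let γ : SOPath R 1 :=
    { toFun := fun t => complexRotation P A (Real.pi * (1 - t))
      mem := fun t _ => complexRotation_mem_specialOrthogonalGroup hPt hAt hP hPA hAP hA _
      contDiffOn := fun i j => by
        simp only [complexRotation, Matrix.smul_apply, Matrix.add_apply, smul_eq_mul]
        exact ContDiff.contDiffOn (by fun_prop)
      source := by
        rw [hRP]
        simp only [complexRotation, sub_zero, mul_one, Real.cos_pi, Real.sin_pi]
        module
      target := by simp [complexRotation_zero] }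
  refine ⟨γ, ?_⟩
  have hspeed : ∀ t ∈ Set.uIcc (0 : ℝ) 1,
      √(soMetric (γ.toFun t) (γ.velocity t) (γ.velocity t)) = Real.pi * √(soLevel R / 2) := by
    intro t ht
    rw [Set.uIcc_of_le zero_le_one] at ht
    have hv : γ.velocity t = Real.pi •
        (Real.sin (Real.pi * (1 - t)) • P - Real.cos (Real.pi * (1 - t)) • A) := by
      ext i j
      exact (hderiv i j t).hasDerivWithinAt.derivWithin (uniqueDiffOn_Icc zero_lt_one t ht)
    have hγ : γ.toFun t = complexRotation P A (Real.pi * (1 - t)) := rfl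
    have hcs := Real.sin_sq_add_cos_sq (Real.pi * (1 - t))
    set c := Real.cos (Real.pi * (1 - t)) with hc
    set s := Real.sin (Real.pi * (1 - t)) with hs
    -- the velocity is `-π γ A`
    have hUv : (γ.toFun t)ᵀ * γ.velocity t = -(Real.pi • A) := by
      rw [hγ, hv, transpose_complexRotation hPt hAt]
      simp only [complexRotation, Real.cos_neg, Real.sin_neg, ← hc, ← hs, Matrix.add_mul,
        Matrix.mul_sub, Matrix.one_mul, Matrix.smul_mul, Matrix.mul_smul, hP, hPA, hAP, hA]
      match_scalars
      · ring
      · linear_combination (-Real.pi) * hcs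
    have hmet : soMetric (γ.toFun t) (γ.velocity t) (γ.velocity t)
        = Real.pi ^ 2 * (soLevel R / 2) := by
      rw [soMetric, hUv, neg_mul_neg, Matrix.smul_mul, Matrix.mul_smul, hA, Matrix.trace_smul,
        Matrix.trace_smul, Matrix.trace_neg, htr]
      simp only [smul_eq_mul]
      ring
    rw [hmet, Real.sqrt_mul (sq_nonneg _), Real.sqrt_sq Real.pi_pos.le]
  rw [SOPath.length, intervalIntegral.integral_congr hspeed]
  simp

/-! ### Even sign changes -/

section SignChange

variable {p : ℕ} (σ : EvenSignChange p)

theorem EvenSignChange.even_level : Even σ.level := by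
  have h : ∏ i, σ.1 i = (-1) ^ σ.level := by
    rw [EvenSignChange.level, ← Finset.prod_const, Finset.prod_filter]
    refine Finset.prod_congr rfl fun i _ => ?_
    rcases Int.units_eq_one_or (σ.1 i) with h | h <;> simp [h]
  rw [σ.2] at h
  by_contra hodd
  rw [Nat.not_even_iff_odd] at hodd
  rw [hodd.neg_one_pow] at h
  exact absurd h (by decide)

theorem EvenSignChange.toSO_eq_one (h : σ.level = 0) : σ.toSO = 1 := by
  have h1 : ∀ i, σ.1 i = 1 := fun i => by
    rw [EvenSignChange.level, Finset.card_eq_zero, Finset.filter_eq_empty_iff] at h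
    exact (Int.units_eq_one_or _).resolve_right (h (Finset.mem_univ i))
  ext i j
  simp [EvenSignChange.toSO, h1]

theorem EvenSignChange.rank_one_sub_toSO :
    (1 - (σ.toSO : Matrix (Fin p) (Fin p) ℝ)).rank = σ.level := by
  have h : (1 - (σ.toSO : Matrix (Fin p) (Fin p) ℝ))
      = Matrix.diagonal fun i => 1 - ((σ.1 i : ℤ) : ℝ) := by
    rw [EvenSignChange.toSO, ← Matrix.diagonal_one, Matrix.diagonal_sub]
  rw [h, Matrix.rank_diagonal, Fintype.card_subtype, EvenSignChange.level]
  congr 1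
  ext i
  rcases Int.units_eq_one_or (σ.1 i) with h | h <;> norm_num [h]

theorem EvenSignChange.toSO_mul_self :
    (σ.toSO : Matrix (Fin p) (Fin p) ℝ) * (σ.toSO : Matrix (Fin p) (Fin p) ℝ) = 1 := by
  rw [EvenSignChange.toSO, Matrix.diagonal_mul_diagonal, ← Matrix.diagonal_one]
  congr 1
  ext i
  rcases Int.units_eq_one_or (σ.1 i) with h | h <;> simp [h]

/-- If `R` is an involution then `R I_σ` is `-1` on the intersection of the `1`-eigenspace of `R`
and the `(-1)`-eigenspace of `I_σ`, whose dimension is at least `level σ - level R`. -/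
theorem EvenSignChange.exists_orthonormal_mul_toSO {R : SO p} (hR : R * R = 1) :
    ∃ (n : ℕ) (E : Matrix (Fin p) (Fin n) ℝ), σ.level ≤ n + soLevel R ∧ Eᵀ * E = 1 ∧
      ((R * σ.toSO : SO p) : Matrix (Fin p) (Fin p) ℝ) * E = -E := by
  let S : Matrix (Fin p) (Fin p) ℝ := σ.toSO
  let Rm : Matrix (Fin p) (Fin p) ℝ := R
  let W := LinearMap.range (Matrix.mulVecLin (1 - S))
  let N := LinearMap.ker (Matrix.mulVecLin (Rm - 1))
  obtain ⟨E, hE, hcol, -⟩ := Submodule.exists_orthonormal_matrix (W ⊓ N)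
  refine ⟨_, E, ?_, hE, ?_⟩
  · have hW : Module.finrank ℝ W = σ.level := σ.rank_one_sub_toSO
    have hN := LinearMap.finrank_range_add_finrank_ker (Matrix.mulVecLin (Rm - 1))
    have hrange : LinearMap.range (Matrix.mulVecLin (Rm - 1))
        ≤ Module.End.eigenspace (Matrix.toLin' (R : Matrix (Fin p) (Fin p) ℝ)) (-1) := by
      rintro _ ⟨v, rfl⟩
      rw [mem_eigenspace_neg_one, Matrix.mulVecLin_apply, Matrix.mulVec_mulVec, Matrix.mul_sub,
        SO.coe_mul_self hR, Matrix.mul_one, ← Matrix.neg_mulVec, neg_sub]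
    have hle := Submodule.finrank_mono hrange
    have hsum := Submodule.finrank_sup_add_finrank_inf_eq W N
    have hN' : Module.finrank ℝ N = Module.finrank ℝ
        (LinearMap.ker (Matrix.mulVecLin (Rm - 1))) := rfl
    have hsup := Submodule.finrank_le (W ⊔ N)
    rw [Module.finrank_fin_fun] at hN hsup
    change _ ≤ soLevel R at hle
    omega
  · have h : ∀ v ∈ W ⊓ N, (Rm * S) *ᵥ v = -v := by
      rintro v ⟨⟨w, hw⟩, hv⟩
      have h1 : S *ᵥ v = -v := by
        rw [← hw, Matrix.mulVecLin_apply, Matrix.mulVec_mulVec, Matrix.mul_sub,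
          σ.toSO_mul_self, Matrix.mul_one, ← Matrix.neg_mulVec, neg_sub]
      have h2 : Rm *ᵥ v = v := by
        have hv' : (Rm - 1) *ᵥ v = 0 := hv
        rwa [Matrix.sub_mulVec, Matrix.one_mulVec, sub_eq_zero] at hv'
      rw [← Matrix.mulVec_mulVec, h1, Matrix.mulVec_neg, h2]
    ext i j
    exact congrFun (h _ (hcol j)) i

end SignChange

/-! ### Distances to the identity -/

theorem ofReal_le_soDist_one {p n : ℕ} {U : SO p} {E : Matrix (Fin p) (Fin n) ℝ}
    (hE : Eᵀ * E = 1) (hUE : (U : Matrix (Fin p) (Fin p) ℝ) * E = -E) :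
    ENNReal.ofReal (Real.pi * √(n / 2)) ≤ soDist U 1 :=
  le_iInf fun γ => ENNReal.ofReal_le_ofReal (γ.pi_mul_sqrt_le_length hE hUE)

theorem soDist_one_le_of_involution {p : ℕ} {R : SO p} (hR : R * R = 1) :
    soDist R 1 ≤ ENNReal.ofReal (Real.pi * √(soLevel R / 2)) := by
  obtain ⟨γ, hγ⟩ := exists_SOPath_length_eq hR
  exact hγ ▸ iInf_le (fun γ : SOPath R 1 => ENNReal.ofReal γ.length) γ

theorem EvenSignChange.Reduces.level_lt {p : ℕ} {R : SO p} (hR : R * R = 1)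
    {σ : EvenSignChange p} (hσ : σ.Reduces R) : σ.level < 2 * soLevel R := by
  by_contra! hle
  obtain ⟨n, E, hn, hE, hRE⟩ := σ.exists_orthonormal_mul_toSO hR
  refine hσ.not_ge ?_
  calc soDist R 1 ≤ ENNReal.ofReal (Real.pi * √(soLevel R / 2)) := soDist_one_le_of_involution hR
    _ ≤ ENNReal.ofReal (Real.pi * √(n / 2)) := by
        gcongr
        omega
    _ ≤ soDist (R * σ.toSO) 1 := ofReal_le_soDist_one hE hRE

theorem mainTheorem9 (p : ℕ) :
    (∀ R : SO p, IsSOInvolution R → soLevel R = 2 →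
      IsSignChangeReducible R → IsReducibleByLevel R 2) ∧
    (∀ R : SO p, IsSOInvolution R →
      ∀ σ : EvenSignChange p, σ.Reduces R → σ.level < 2 * soLevel R) := by
  refine ⟨?_, fun R hR σ hσ => hσ.level_lt hR.1⟩
  rintro R hR hlevel ⟨σ, hσ⟩
  refine ⟨σ, ?_, hσ⟩
  have hlt := hσ.level_lt hR.1
  obtain ⟨k, hk⟩ := σ.even_level
  have h0 : σ.level ≠ 0 := fun h => by
    rw [EvenSignChange.Reduces, σ.toSO_eq_one h, mul_one] at hσ
    exact lt_irrefl _ hσ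
  omega
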